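/- **Setting.** Let $G$ be a dag on the vertices $1,\dots,N$ with a single sink, vertex $1$, whose edges $(i',i)$ (from $i'$ to $i$) satisfy $i'>i$, whose sources are exactly the vertices $n+1,\dots,N$, and in which every non-source vertex has in-degree $2$; let $m\ge N$. The clauses $\mathrm{Stone}(G,m)$ in the variables $p_{i,j}$, $r_j$ ($1\le i\le N$, $1\le j\le m$) are: $\bigvee_{j} p_{i,j}$ for every vertex $i$; $\overline p_{i,j}\lor r_j$ for every source $i$ and every $j$; $\overline p_{1,j}\lor\overline r_j$ for every $j$; and $\overline p_{i',j'}\lor\overline r_{j'}\lor\overline p_{i'',j''}\lor\overline r_{j''}\lor\overline p_{i,j}\lor r_j$ whenever $i',i''$ are the two predecessors of $i$ and $j\notin\{j',j''\}$. A clause is a set of literals. Resolution on a literal $x$ infers $(A\setminus\{x\})\cup(B\setminus\{\overline x\})$ from $A,B$, where $x\in A$, $\overline x\notin A$, $\overline x\in B$, $x\notin B$. **regRTI derivations.** A regRTI derivation of a clause $D$ from a set $\Gamma$ of clauses is a binary tree of resolution inferences with root $D$ in which no variable is resolved on twice along a branch, no variable of $D$ is resolved on, and every leaf is a clause of $\Gamma$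 or a lemma, i.e. a clause derived earlier in the postorder of the tree by an input subderivation (one in which every inference has at least one hypothesis that is a leaf). Its size is its number of nodes. A partially formed regRTI refutation $R$ of $\Gamma$ is such a tree with root $\emptyset$ that may also have unfinished leaves, carrying arbitrary clauses, all of them to the right of all other (finished) leaves. The learned clauses of $R$ at its leftmost unfinished leaf (at the end of $R$ if there is none) are the clauses of $\Gamma$ and those derived before it in postorder by an input subderivation. For a leaf $C$, $C^{\mathrm{pool}}$ is the set of all literals in clauses on the path from the root to $C$, inclusive, and $\mathrm{dom}(D)=\{i: \overline p_{i,j}\in D\text{ for some }j\}$. **Learning.** Let $i$ have the two predecessors $i',i''$. The clause $\overline p_{i,j}\lor r_j$ is always $0$-learned; it is $1$-learned if all $\overline p_{i',j'}\lor\overline p_{i'',j''}\lor\overline p_{i,j}\lor r_j$ with $j',j''\ne j$ are learned, $2$-learned if all $\overline p_{i'',j''}\lor\overline p_{i,j}\lor r_j$ with $j''\ne j$ are learned, and $3$-learned if it is learned itself. A vertex $i$ (possibly a source) is $3$-learned if $\overline p_{i,j}\lor r_j$ is learned for every $j$. **Well-formed and extendible clauses.** Let $C=\overline p_{i_1,j_1}\lor\dots\lor\overline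 p_{i_k,j_k}$ with $k\ge1$ and $i_1<\dots<i_k$ be the leftmost unfinished leaf of $R$. The vertex $i_\ell$ is bypassed if $j_{\ell'}=j_\ell$ for some $\ell'>\ell$; for the largest such $\ell'$, $i_{\ell'}$ is its max-bypasser. For $\ell<\ell'$, $i_{\ell'}$ directly supports $i_\ell$ if it is the max-bypasser of $i_\ell$, or if $i_\ell$ is not bypassed and $i_{\ell'}$ is a predecessor of $i_\ell$; "supports" is the reflexive transitive closure. $C$ is well-formed if $i_1=1$, $i_k\le n$, and 1. all literals in $C^{\mathrm{pool}}$ are of the form $\overline p_{i,j}$ or $p_{i,j}$ with $i\le i_k$, and for each $i$ there is at most one $j$ with $\overline p_{i,j}\in C^{\mathrm{pool}}$; 2. for each non-bypassed $i_\ell$, each predecessor $i'$ of $i_\ell$ satisfies ($\alpha$) $i'\in\mathrm{dom}(C)$, or ($\beta$) $i'$ is $3$-learned and $i'\notin\mathrm{dom}(C^{\mathrm{pool}})$, or ($\gamma$) $i'>i_k$ and $i'$ is not $3$-learned; 3. every $i_\ell$ supports $i_1$. $C$ is extendible if some predecessor of some non-bypassed $i_\ell$ satisfies ($\gamma$). (The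 empty clause counts as extendible.) **Lemma.** There is an absolute constant $c$ such that the following holds for all $N\le m$, all $G$ as above, and every partially formed regRTI refutation $R$ of $\mathrm{Stone}(G,m)$. Let the leftmost unfinished leaf of $R$ be a well-formed, non-extendible clause $C=\overline p_{i_1,j_1}\lor\dots\lor\overline p_{i_k,j_k}$, $k\ge1$. Let $i',i''$ be the two predecessors of $i_k$, in either order, and let $K<3$ be such that $\overline p_{i_k,j_k}\lor r_{j_k}$ is $K$-learned at $C$ (for instance $K=0$, or the largest such $K$ if that is less than $3$). Then there is a regRTI derivation $R_C$ of $C$ from the learned clauses of $R$ at $C$ (which include the Stone clauses) such that - $R_C$ has size at most $c\,N m^2$; - the only variables resolved on in $R_C$ are variables $r_j$, and variables $p_{i,j}$ with $i\notin\mathrm{dom}(C^{\mathrm{pool}})$; - after the leaf $C$ of $R$ is replaced by $R_C$, the clause $\overline p_{i_k,j_k}\lor r_{j_k}$ is $(K+1)$-learned. -/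

import Mathlib

namespace StoneRTI

/-! ### Literals, clauses, resolution -/

/-- A literal: a variable or a negated variable. -/
inductive Literal (V : Type) where
  | pos (v : V)
  | neg (v : V)
  deriving DecidableEq

/-- The variable of a literal. -/
def Literal.var {V : Type} : Literal V → V
  | .pos v => v
  | .neg v => v

/-- The complementary literal. -/
def Literal.compl {V : Type} : Literal V → Literal V
  | .pos v => .neg v
  | .neg v => .pos v

/-- A clause is a (finite) set of literals, read as their disjunction. -/
abbrev Clause (V : Type) : Type := Finset (Literal V)

/-- The resolution rule: `A`, `B` yield `C` by resolving on the literal `x`. -/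
def IsResolvent {V : Type} [DecidableEq V] (x : Literal V) (A B C : Clause V) : Prop :=
  x ∈ A ∧ x.compl ∉ A ∧ x.compl ∈ B ∧ x ∉ B ∧ C = A.erase x ∪ B.erase x.compl

/-! ### Tree-like (partial) derivations -/

/-- A tree-like, possibly partial derivation. A leaf is either finished or unfinished; an
internal node carries its clause, the literal that is resolved on, and its left and right
subtrees. -/
inductive ProofTree (V : Type) where
  | finished (A : Clause V)
  | unfinished (A : Clause V)
  | node (A : Clause V) (x : Literal V) (left right : ProofTree V)

namespace ProofTree

variable {V : Type}

/-- The clause at the root. -/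
def clause : ProofTree V → Clause V
  | finished A => A
  | unfinished A => A
  | node A _ _ _ => A

/-- The size: the number of clauses (nodes). -/
def size : ProofTree V → ℕ
  | finished _ => 1
  | unfinished _ => 1
  | node _ _ l r => l.size + r.size + 1

/-- The variables that are used as resolution variables. -/
def resVars : ProofTree V → Set V
  | finished _ => ∅
  | unfinished _ => ∅
  | node _ x l r => {x.var} ∪ (l.resVars ∪ r.resVars)

/-- No variable is resolved on twice along a branch. -/
def Regular : ProofTree V → Prop
  | finished _ => True
  | unfinished _ => True
  | node _ x l r => x.var ∉ l.resVars ∧ x.var ∉ r.resVars ∧ l.Regular ∧ r.Regular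

/-- There is no unfinished leaf. -/
def isComplete : ProofTree V → Bool
  | finished _ => true
  | unfinished _ => false
  | node _ _ l r => l.isComplete && r.isComplete

/-- There is no finished leaf. -/
def NoFinished : ProofTree V → Prop
  | finished _ => False
  | unfinished _ => True
  | node _ _ l r => l.NoFinished ∧ r.NoFinished

/-- All finished leaves are to the left of all unfinished leaves. -/
def FinishedLeft : ProofTree V → Prop
  | finished _ => True
  | unfinished _ => True
  | node _ _ l r => l.FinishedLeft ∧ r.FinishedLeft ∧ (l.isComplete = true ∨ r.NoFinished)

/-- The root is a finished leaf. -/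
def IsFinishedLeaf : ProofTree V → Prop
  | finished _ => True
  | _ => False

/-- A (complete) input derivation: every inference has a hypothesis that is a leaf, that is, an
initial clause or a lemma. -/
def IsInput : ProofTree V → Prop
  | finished _ => True
  | unfinished _ => False
  | node _ _ l r => (l.IsFinishedLeaf ∨ r.IsFinishedLeaf) ∧ l.IsInput ∧ r.IsInput

/-- The clauses derived in the tree by an input subderivation. (The clause of a finished leaf
is already available where that leaf is used, so leaves contribute nothing new.) -/
def inputDerived : ProofTree V → Set (Clause V)
  | finished _ => ∅
  | unfinished _ => ∅
  | node A x l r =>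
      l.inputDerived ∪ r.inputDerived ∪ {D | D = A ∧ (node A x l r).IsInput}

/-- Correctness of the tree, traversed in postorder starting with the available clauses `L`:
every inference is a resolution inference, and each finished leaf carries a clause that is in `L`
or was derived by an input subderivation earlier in the postorder. (The nodes that precede a leaf
of the right subtree in postorder are those of the left subtree and those preceding it in the
right subtree; the node itself comes after both.) -/
def Valid [DecidableEq V] : Set (Clause V) → ProofTree V → Prop
  | L, finished A => A ∈ L
  | _, unfinished _ => True
  | L, node A x l r =>
      IsResolvent x l.clause r.clause A ∧ Valid L l ∧ Valid (L ∪ l.inputDerived) r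

/-- The clause `C` of the leftmost unfinished leaf (if there is one), together with the clause
`C^pool`, the set of all literals in the clauses on the path from the root to that leaf,
inclusive. -/
def leftmostUnfinished [DecidableEq V] : ProofTree V → Option (Clause V × Clause V)
  | finished _ => none
  | unfinished A => some (A, A)
  | node A _ l r =>
      (l.leftmostUnfinished.or r.leftmostUnfinished).map fun q => (q.1, A ∪ q.2)

/-- Replace the leftmost unfinished leaf (if there is one) by the tree `S`. -/
def replaceLeftmost (S : ProofTree V) : ProofTree V → ProofTree V
  | finished A => finished A
  | unfinished _ => S
  | node A x l r =>
      if l.isComplete then node A x l (replaceLeftmost S r) else node A x (replaceLeftmost S l) r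

end ProofTree

/-- `T` is a regRTI derivation of `C` from the initial clauses `Γ`. -/
structure IsRegRTIDerivation {V : Type} [DecidableEq V] (Γ : Set (Clause V)) (T : ProofTree V)
    (C : Clause V) : Prop where
  complete : T.isComplete = true
  root : T.clause = C
  valid : T.Valid Γ
  regular : T.Regular
  root_regular : ∀ x ∈ C, x.var ∉ T.resVars

/-- `R` is a partially formed regRTI refutation of `Γ`: its root is the empty clause, it is
regular, its inferences are correct, its finished leaves are learned, and they are all to the left
of the unfinished leaves. -/
structure IsPartialRegRTIRefutation {V : Type} [DecidableEq V] (Γ : Set (Clause V))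
    (R : ProofTree V) : Prop where
  root : R.clause = ∅
  valid : R.Valid Γ
  regular : R.Regular
  finishedLeft : R.FinishedLeft

/-- The clauses that are learned when the leftmost unfinished leaf of the partially formed
refutation `R` of `Γ` is reached (or at the end of `R`, if no leaf is unfinished): the members of
`Γ`, and the clauses derived before that leaf in postorder by an input subderivation. As all leaves
to the right of the leftmost unfinished leaf are unfinished, every (complete) input subderivation
of `R` that contains an inference comes before that leaf in postorder. -/
def learnedClauses {V : Type} (Γ : Set (Clause V)) (R : ProofTree V) : Set (Clause V) :=
  Γ ∪ R.inputDerived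

/-! ### The Stone clauses

The vertices `1, …, N` are represented by `Fin N`, the stones `1, …, m` by `Fin m`, both counting
from zero. In particular the sink, vertex `1`, is the element with value `0`, and the non-source
vertices `1, …, n` are those with value `< n`. -/

/-- The assumptions on the dag: `G.Adj i' i` is an edge from `i'` to `i`. -/
structure IsStoneDag {N : ℕ} (G : Digraph (Fin N)) (n : ℕ) : Prop where
  pos : 0 < N
  edge_lt : ∀ i' i, G.Adj i' i → i < i'
  source_iff : ∀ i, (∀ i', ¬ G.Adj i' i) ↔ n ≤ i.val
  indegree : ∀ i : Fin N, i.val < n → {i' | G.Adj i' i}.ncard = 2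
  sink_iff : ∀ i, (∀ i', ¬ G.Adj i i') ↔ i.val = 0

/-- The variables `p_{i,j}` and `r_j`. -/
inductive StoneVar (N m : ℕ) where
  | p (i : Fin N) (j : Fin m)
  | r (j : Fin m)
  deriving DecidableEq

section

variable {N m : ℕ}

/-- The literal `p_{i,j}`. -/
def pPos (i : Fin N) (j : Fin m) : Literal (StoneVar N m) := .pos (.p i j)

/-- The literal `¬p_{i,j}`. -/
def pNeg (i : Fin N) (j : Fin m) : Literal (StoneVar N m) := .neg (.p i j)

/-- The literal `r_j`. -/
def rPos (j : Fin m) : Literal (StoneVar N m) := .pos (.r j)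

/-- The literal `¬r_j`. -/
def rNeg (j : Fin m) : Literal (StoneVar N m) := .neg (.r j)

/-- `i'` and `i''` are the two predecessors of `i`. -/
def ArePredecessors (G : Digraph (Fin N)) (i' i'' i : Fin N) : Prop :=
  i' ≠ i'' ∧ G.Adj i' i ∧ G.Adj i'' i

/-- The clauses of `Stone(G, m)`. -/
inductive StoneClause (G : Digraph (Fin N)) (m : ℕ) : Clause (StoneVar N m) → Prop
  | pebbled (i : Fin N) : StoneClause G m (Finset.univ.image fun j : Fin m => pPos i j)
  | source (i : Fin N) (j : Fin m) (hi : ∀ i', ¬ G.Adj i' i) :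
      StoneClause G m {pNeg i j, rPos j}
  | sink (i : Fin N) (j : Fin m) (hi : i.val = 0) : StoneClause G m {pNeg i j, rNeg j}
  | induction (i' i'' i : Fin N) (j' j'' j : Fin m) (hi : ArePredecessors G i' i'' i)
      (hj' : j ≠ j') (hj'' : j ≠ j'') :
      StoneClause G m {pNeg i' j', rNeg j', pNeg i'' j'', rNeg j'', pNeg i j, rPos j}

/-- The set `Stone(G, m)`. -/
def stone (G : Digraph (Fin N)) (m : ℕ) : Set (Clause (StoneVar N m)) := {A | StoneClause G m A}

/-! ### Learning -/

/-- With `L` the set of learned clauses and `i'`, `i''` the two predecessors of `i`: the clause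
`¬p_{i,j} ∨ r_j` is `K`-learned (`K = 0, 1, 2, 3`). -/
def KLearned (L : Set (Clause (StoneVar N m))) (i' i'' i : Fin N) (j : Fin m) : ℕ → Prop
  | 0 => True
  | 1 => ∀ j' j'' : Fin m, j' ≠ j → j'' ≠ j →
      ({pNeg i' j', pNeg i'' j'', pNeg i j, rPos j} : Clause (StoneVar N m)) ∈ L
  | 2 => ∀ j'' : Fin m, j'' ≠ j →
      ({pNeg i'' j'', pNeg i j, rPos j} : Clause (StoneVar N m)) ∈ L
  | 3 => ({pNeg i j, rPos j} : Clause (StoneVar N m)) ∈ L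
  | _ => False

/-- The vertex `i` is 3-learned: all clauses `¬p_{i,j} ∨ r_j` are learned. -/
def Vertex3Learned (L : Set (Clause (StoneVar N m))) (i : Fin N) : Prop :=
  ∀ j : Fin m, ({pNeg i j, rPos j} : Clause (StoneVar N m)) ∈ L

/-! ### Unfinished clauses

A non-empty unfinished clause `¬p_{i_1,j_1} ∨ ⋯ ∨ ¬p_{i_k,j_k}`, `k ≥ 1`, is given by the two
sequences `i`, `j` indexed by `Fin (k + 1)` (so that the code's `k` is one less, `i 0` is `i_1`
and `i (Fin.last k)` is `i_k`). -/

/-- The vertices `i` such that some `¬p_{i,j}` is in the clause. -/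
def dom (A : Clause (StoneVar N m)) : Set (Fin N) := {i | ∃ j, pNeg i j ∈ A}

variable {k : ℕ}

/-- The clause `¬p_{i_1,j_1} ∨ ⋯ ∨ ¬p_{i_k,j_k}`. -/
def unfinishedClause (i : Fin (k + 1) → Fin N) (j : Fin (k + 1) → Fin m) :
    Clause (StoneVar N m) :=
  Finset.univ.image fun l => pNeg (i l) (j l)

/-- The vertex `i_l` is bypassed. -/
def Bypassed (j : Fin (k + 1) → Fin m) (l : Fin (k + 1)) : Prop := ∃ l', l < l' ∧ j l' = j l

/-- `i_{l'}` is the max-bypasser of `i_l`. -/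
def IsMaxBypasser (j : Fin (k + 1) → Fin m) (l' l : Fin (k + 1)) : Prop :=
  IsGreatest {l'' | l < l'' ∧ j l'' = j l} l'

/-- `i_{l'}` directly supports `i_l`. -/
def DirectlySupports (G : Digraph (Fin N)) (i : Fin (k + 1) → Fin N) (j : Fin (k + 1) → Fin m)
    (l' l : Fin (k + 1)) : Prop :=
  l < l' ∧ (IsMaxBypasser j l' l ∨ (¬ Bypassed j l ∧ G.Adj (i l') (i l)))

/-- `i_{l'}` supports `i_l`: the reflexive, transitive closure of direct support. -/
def Supports (G : Digraph (Fin N)) (i : Fin (k + 1) → Fin N) (j : Fin (k + 1) → Fin m) :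
    Fin (k + 1) → Fin (k + 1) → Prop :=
  Relation.ReflTransGen (DirectlySupports G i j)

/-- Condition (γ) on a vertex `i'`: it is greater than `i_k` and not 3-learned. -/
def CondGamma (L : Set (Clause (StoneVar N m))) (i : Fin (k + 1) → Fin N) (i' : Fin N) : Prop :=
  i (Fin.last k) < i' ∧ ¬ Vertex3Learned L i'

/-- The non-empty clause `C = unfinishedClause i j` is a well-formed unfinished clause, where `L`
is the set of learned clauses and `P` is `C^pool`. The condition on the literals of `C^pool` has to
admit positive literals `p_{a,b}`: a clause `C, ¬p_{i,t}` produced by extending `C` lies above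
clauses that contain `p_{i,s}` for `s > t`. -/
structure IsWellFormed (G : Digraph (Fin N)) (n : ℕ) (L : Set (Clause (StoneVar N m)))
    (P : Clause (StoneVar N m)) (i : Fin (k + 1) → Fin N) (j : Fin (k + 1) → Fin m) : Prop where
  strictMono : StrictMono i
  first : (i 0).val = 0
  last : (i (Fin.last k)).val < n
  pool_form : ∀ x ∈ P, ∃ a b, (x = pNeg a b ∨ x = pPos a b) ∧ a ≤ i (Fin.last k)
  pool_unique : ∀ a b b', pNeg a b ∈ P → pNeg a b' ∈ P → b = b'
  predecessors : ∀ l, ¬ Bypassed j l → ∀ i', G.Adj i' (i l) →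
    i' ∈ dom (unfinishedClause i j) ∨ (Vertex3Learned L i' ∧ i' ∉ dom P) ∨ CondGamma L i i'
  supports : ∀ l, Supports G i j l 0

/-- The non-empty unfinished clause is extendible: some `i_l` that is not bypassed has a
predecessor that satisfies (γ). -/
def Extendible (G : Digraph (Fin N)) (L : Set (Clause (StoneVar N m)))
    (i : Fin (k + 1) → Fin N) (j : Fin (k + 1) → Fin m) : Prop :=
  ∃ l, ¬ Bypassed j l ∧ ∃ i', G.Adj i' (i l) ∧ CondGamma L i i'

end

end StoneRTI

open StoneRTI

/-! The main branch of `R_C` starts at the sink clause `¬p_{i_1,j_1} ∨ ¬r_{j_1}` and passes through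
`i_1, …, i_k`. At a vertex `i_l` that is not bypassed, if `¬r_{j_l}` is present, it is resolved
against a side clause (`exists_sideClause`). This trades `¬r_{j_l}` for `¬p_{i_l,j_l}`, the literals
of `C` at predecessors of `i_l`, and possibly some `¬r_{j_y}` with `y > l`. A bypassed vertex is
skipped: its `¬r` literal waits for the last vertex with the same stone, so each `r_t` is resolved
on at most once along the main branch. By `IsMainClause`, once the last vertex with the stone of a
collected vertex is passed, the direct supporters of that vertex have been collected. Since every
`i_l` supports `i_1`, the final clause is exactly `C`.

Non-extendibility leaves two kinds of predecessors. One in `dom C` keeps its stone. A 3-learned one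
outside `dom(C^pool)` is eliminated by running over all its stones (`exists_eliminate`). A literal
`¬r_t` is removed by the learned clause `¬p_{c,t} ∨ r_t` only if `t` is not the stone of a later
vertex: otherwise `r_t` may be resolved on nearer to the root, and regularity would fail.

At `i_k` both predecessors are 3-learned and there are no later stones, so the side clause is
`¬p_{i_k,j_k} ∨ r_{j_k}` itself. Its derivation has three nested layers; a layer is input as soon as
the clauses of the layer inside it are available as leaves, so one more level is learned
(`exists_derivation_kLearned`). Each side derivation has size `O(m^2)`, and `k ≤ N`. -/

namespace StoneRTI

/-! ### Proof trees: completeness, monotonicity and replacement of a leaf -/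

namespace ProofTree

variable {V : Type}

theorem IsFinishedLeaf.isInput : ∀ {T : ProofTree V}, T.IsFinishedLeaf → T.IsInput
  | finished _, _ => trivial

theorem replaceLeftmost_of_isComplete (S : ProofTree V) {T : ProofTree V}
    (h : T.isComplete = true) : replaceLeftmost S T = T := by
  induction T with
  | finished A => rfl
  | unfinished A => simp [isComplete] at h
  | node A x l r ihl ihr =>
    simp only [isComplete, Bool.and_eq_true] at h
    simp [replaceLeftmost, h.1, ihr h.2]

theorem inputDerived_subset_replaceLeftmost_of_not_isComplete (S : ProofTree V) {T : ProofTree V}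
    (h : T.isComplete ≠ true) : S.inputDerived ⊆ (replaceLeftmost S T).inputDerived := by
  induction T with
  | finished A => simp [isComplete] at h
  | unfinished A => exact subset_rfl
  | node A x l r ihl ihr =>
    intro D hD
    by_cases hl : l.isComplete = true
    · have hr : r.isComplete ≠ true := by simpa [isComplete, hl] using h
      simp only [replaceLeftmost, hl, if_true]
      exact Or.inl (Or.inr (ihr hr hD))
    · simp only [replaceLeftmost, hl]
      exact Or.inl (Or.inl (ihl hl hD))

variable [DecidableEq V]

theorem Valid.mono {T : ProofTree V} : ∀ {L L' : Set (Clause V)}, L ⊆ L' → T.Valid L → T.Valid L' := by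
  induction T with
  | finished A => exact fun h hA => h hA
  | unfinished A => exact fun _ _ => trivial
  | node A x l r ihl ihr =>
    exact fun h hT => ⟨hT.1, ihl h hT.2.1, ihr (Set.union_subset_union_left _ h) hT.2.2⟩

theorem subset_of_leftmostUnfinished_eq_some {T : ProofTree V} :
    ∀ {C P : Clause V}, T.leftmostUnfinished = some (C, P) → C ⊆ P := by
  induction T with
  | finished A => simp [leftmostUnfinished]
  | unfinished A => simp +contextual [leftmostUnfinished]
  | node A x l r ihl ihr =>
    intro C P h
    simp only [leftmostUnfinished, Option.map_eq_some_iff, Option.or_eq_some_iff] at h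
    obtain ⟨⟨C', P'⟩, h, he⟩ := h
    obtain ⟨rfl, rfl⟩ := Prod.mk.inj he
    refine Finset.Subset.trans ?_ Finset.subset_union_right
    rcases h with h | h
    · exact ihl h
    · exact ihr h.2

theorem leftmostUnfinished_eq_none_iff {T : ProofTree V} :
    T.leftmostUnfinished = none ↔ T.isComplete = true := by
  induction T with
  | finished A => simp [leftmostUnfinished, isComplete]
  | unfinished A => simp [leftmostUnfinished, isComplete]
  | node A x l r ihl ihr => simp [leftmostUnfinished, isComplete, ihl, ihr]

end ProofTree

/-! ### Regular derivations with a bound on the resolution variables -/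

open ProofTree

/-- `T` is a regular derivation of `D` from `Γ` that resolves only on variables in `W`. -/
structure IsDerivation {V : Type} [DecidableEq V] (Γ : Set (Clause V)) (W : Set V)
    (T : ProofTree V) (D : Clause V) : Prop where
  complete : T.isComplete = true
  root : T.clause = D
  valid : T.Valid Γ
  regular : T.Regular
  resVars_subset : T.resVars ⊆ W

namespace IsDerivation

variable {V : Type} [DecidableEq V] {Γ : Set (Clause V)} {W W' : Set V} {T T' : ProofTree V}
  {A B D : Clause V} {x : Literal V}

theorem leaf (hA : A ∈ Γ) : IsDerivation Γ W (finished A) A :=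
  ⟨rfl, rfl, hA, trivial, Set.empty_subset _⟩

theorem mono (h : IsDerivation Γ W T D) (hW : W ⊆ W') : IsDerivation Γ W' T D :=
  { h with resVars_subset := h.resVars_subset.trans hW }

theorem resolve (hA : IsDerivation Γ W T A) (hB : IsDerivation Γ W T' B)
    (hx : x.var ∉ W) (h : IsResolvent x A B D) :
    IsDerivation Γ (insert x.var W) (node D x T T') D where
  complete := by simp [isComplete, hA.complete, hB.complete]
  root := rfl
  -- Every leaf is already in `Γ`; lemmas learned on the left are never used on the right.
  valid := ⟨by rwa [hA.root, hB.root], hA.valid, hB.valid.mono Set.subset_union_left⟩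
  regular := ⟨fun h' => hx (hA.resVars_subset h'), fun h' => hx (hB.resVars_subset h'),
    hA.regular, hB.regular⟩
  resVars_subset := by
    rintro v (rfl | hv | hv)
    · exact Set.mem_insert _ _
    · exact Or.inr (hA.resVars_subset hv)
    · exact Or.inr (hB.resVars_subset hv)

end IsDerivation

/-! ### Induction clauses and the elimination of one predecessor -/

variable {N m : ℕ}

/-- The clause `p_{c,1} ∨ ⋯ ∨ p_{c,m}` can be resolved against clauses `¬p_{c,j} ∨ F_j`, for all
`j` in `S`. -/
theorem exists_sweep {Γ : Set (Clause (StoneVar N m))} {W : Set (StoneVar N m)} {c : Fin N}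
    (F : Fin m → Clause (StoneVar N m)) (T : Fin m → ProofTree (StoneVar N m)) {q : ℕ}
    (hW : ∀ j, StoneVar.p c j ∉ W)
    (hpeb : (Finset.univ.image fun j : Fin m => pPos c j) ∈ Γ)
    (hF : ∀ j t, pPos c t ∉ F j ∧ pNeg c t ∉ F j)
    (hT : ∀ j, IsDerivation Γ W (T j) (insert (pNeg c j) (F j)))
    (hq : ∀ j, (T j).size ≤ q) (S : Finset (Fin m)) :
    ∃ T', IsDerivation Γ (W ∪ {v | ∃ j ∈ S, v = .p c j}) T'
        (Sᶜ.image (pPos c) ∪ S.biUnion F) ∧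
      T'.size ≤ 1 + S.card * (q + 1) ∧
      (∀ j ∈ S, (T j).inputDerived ⊆ T'.inputDerived) ∧
      ((∀ j ∈ S, (T j).IsFinishedLeaf) →
        T'.IsInput ∧ (S.Nonempty → T'.clause ∈ T'.inputDerived)) := by
  classical
  induction S using Finset.induction_on with
  | empty =>
    refine ⟨finished (Finset.univ.image fun j : Fin m => pPos c j), ?_, by simp [size], by simp,
      fun _ => ⟨trivial, by simp⟩⟩
    simpa using IsDerivation.leaf hpeb
  | insert j S hj ih =>
    obtain ⟨T₁, h₁, hs, hI, hleaf⟩ := ih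
    have hres : IsResolvent (pPos c j) (Sᶜ.image (pPos c) ∪ S.biUnion F)
        (insert (pNeg c j) (F j)) ((insert j S)ᶜ.image (pPos c) ∪ (insert j S).biUnion F) := by
      have hn : (pPos c j).compl = (pNeg c j : Literal (StoneVar N m)) := rfl
      have hinj : ∀ t, pPos c t = (pPos c j : Literal (StoneVar N m)) ↔ t = j := by
        simp [pPos]
      have hne : ∀ t t', (pPos c t : Literal (StoneVar N m)) ≠ pNeg c t' := by simp [pPos, pNeg]
      refine ⟨?_, ?_, ?_, ?_, ?_⟩
      · simp [hinj, hj]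
      · simp only [hn, Finset.mem_union, Finset.mem_image, Finset.mem_biUnion, not_or]
        refine ⟨?_, ?_⟩
        · rintro ⟨t, -, h⟩; exact hne _ _ h
        · rintro ⟨t, -, h⟩; exact (hF _ _).2 h
      · simp [hn]
      · simp [hne, hF]
      · ext y
        have h1 : ∀ t, y ∈ F t → y ≠ pPos c j := fun t ht h => (hF t j).1 (h ▸ ht)
        have h2 : ∀ t, y ∈ F t → y ≠ pNeg c j := fun t ht h => (hF t j).2 (h ▸ ht)
        simp only [hn, Finset.mem_union, Finset.mem_image, Finset.mem_biUnion, Finset.mem_erase,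
          Finset.mem_insert, Finset.mem_compl]
        constructor
        · rintro (⟨t, ht, rfl⟩ | ⟨t, rfl | ht, hy⟩)
          · exact Or.inl ⟨by rw [ne_eq, hinj]; tauto, Or.inl ⟨t, by tauto, rfl⟩⟩
          · exact Or.inr ⟨h2 _ hy, Or.inr hy⟩
          · exact Or.inl ⟨h1 _ hy, Or.inr ⟨t, ht, hy⟩⟩
        · rintro (⟨hy, ⟨t, ht, rfl⟩ | ⟨t, ht, hy'⟩⟩ | ⟨hy, hy' | hy'⟩)
          · rw [ne_eq, hinj] at hy
            exact Or.inl ⟨t, by tauto, rfl⟩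
          · exact Or.inr ⟨t, Or.inr ht, hy'⟩
          · exact absurd hy' hy
          · exact Or.inr ⟨j, Or.inl rfl, hy'⟩
    refine ⟨node _ (pPos c j) T₁ (T j), (h₁.resolve ((hT j).mono Set.subset_union_left) ?_
      hres).mono ?_, ?_, ?_, ?_⟩
    · rintro (h | ⟨t, ht, h⟩)
      · exact hW _ h
      · obtain rfl : j = t := by simpa [pPos, Literal.var] using h
        exact hj ht
    · rintro v (rfl | hv | ⟨t, ht, rfl⟩)
      · exact Or.inr ⟨j, by simp, rfl⟩
      · exact Or.inl hv
      · exact Or.inr ⟨t, by simp [ht], rfl⟩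
    · have := hq j
      simp only [size, Finset.card_insert_of_notMem hj]
      nlinarith
    · intro t ht D hD
      rcases Finset.mem_insert.1 ht with rfl | ht
      · exact Or.inl (Or.inr hD)
      · exact Or.inl (Or.inl (hI t ht hD))
    · intro hl
      have hin : (node ((insert j S)ᶜ.image (pPos c) ∪ (insert j S).biUnion F) (pPos c j) T₁
          (T j)).IsInput :=
        ⟨Or.inr (hl j (by simp)), (hleaf fun t ht => hl t (by simp [ht])).1,
          (hl j (by simp)).isInput⟩
      exact ⟨hin, fun _ => Or.inr ⟨rfl, hin⟩⟩

/-- The literal `¬p_{c,j}`, together with `¬r_j` if `j` is in `H`. -/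
def stoneOn (H : Finset (Fin m)) (c : Fin N) (j : Fin m) : Clause (StoneVar N m) :=
  insert (pNeg c j) (if j ∈ H then {rNeg j} else ∅)

/-- Resolving on `r_j` against the clause `¬p_{c,j} ∨ r_j`. -/
theorem IsDerivation.erase_rNeg {Γ : Set (Clause (StoneVar N m))} {W : Set (StoneVar N m)}
    {T : ProofTree (StoneVar N m)} {A : Clause (StoneVar N m)} (hT : IsDerivation Γ W T A)
    (hin : T.IsInput) {c : Fin N} {j : Fin m} (hW : StoneVar.r j ∉ W) (hn : rNeg j ∈ A)
    (hp : rPos j ∉ A) (hc : pNeg c j ∈ A) (hΓ : {pNeg c j, rPos j} ∈ Γ) :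
    ∃ T', IsDerivation Γ (insert (.r j) W) T' (A.erase (rNeg j)) ∧ T'.IsInput ∧
      T'.size = T.size + 2 ∧ T'.clause ∈ T'.inputDerived := by
  have hin' : (node (A.erase (rNeg j)) (rNeg j) T (finished {pNeg c j, rPos j})).IsInput :=
    ⟨Or.inr trivial, hin, trivial⟩
  refine ⟨_, hT.resolve (x := rNeg j) (.leaf hΓ) hW ⟨hn, hp, ?_, ?_, ?_⟩, hin', rfl,
    Or.inr ⟨rfl, hin'⟩⟩
  · simp [rNeg, rPos, Literal.compl]
  · simp [rNeg, rPos, pNeg]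
  · ext y
    have : (pNeg c j : Literal (StoneVar N m)) ≠ rNeg j := by simp [pNeg, rNeg]
    simp only [rNeg, rPos, Literal.compl, Finset.mem_union, Finset.mem_erase, Finset.mem_insert,
      Finset.mem_singleton] at *
    constructor
    · tauto
    · rintro (h | ⟨h, rfl | h'⟩)
      · exact h
      · exact ⟨this, hc⟩
      · exact absurd h' h

/-- The innermost layer: an induction clause loses those `¬r` literals whose stones are not reserved
in `H`. At most two resolutions against learned clauses are needed, so the tree is input; `ja ∉ H`
guarantees at least one inference, which is needed for the clause to count as derived. -/
theorem exists_stepDerivation {G : Digraph (Fin N)} {L : Set (Clause (StoneVar N m))}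
    (hL : stone G m ⊆ L) {a b v : Fin N} (hab : ArePredecessors G a b v) {H : Finset (Fin m)}
    {s ja jb : Fin m} (hja : ja ≠ s) (hjb : jb ≠ s)
    (ha : ja ∈ H ∨ {pNeg a ja, rPos ja} ∈ L) (hb : jb ∈ H ∨ {pNeg b jb, rPos jb} ∈ L) :
    ∃ T, IsDerivation L {x | ∃ j, j ∉ H ∧ j ≠ s ∧ x = .r j} T
        (stoneOn H a ja ∪ (stoneOn H b jb ∪ {pNeg v s, rPos s})) ∧ T.size ≤ 5 ∧
      (ja ∉ H → T.clause ∈ T.inputDerived) := by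
  have h0 : ({pNeg a ja, rNeg ja, pNeg b jb, rNeg jb, pNeg v s, rPos s} :
      Clause (StoneVar N m)) ∈ L := hL (.induction a b v ja jb s hab hja.symm hjb.symm)
  have hd : ∀ W, IsDerivation L W _ _ := fun W => IsDerivation.leaf (W := W) h0
  by_cases h1 : ja ∈ H <;> by_cases h2 : jb ∈ H
  · refine ⟨finished {pNeg a ja, rNeg ja, pNeg b jb, rNeg jb, pNeg v s, rPos s}, ?_, ?_,
      fun h => absurd h1 h⟩
    · convert hd _ using 1
      ext y; simp [stoneOn, h1, h2]; tauto
    · simp [size]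
  · obtain ⟨T, hT, -, hs', -⟩ := (hd ∅).erase_rNeg trivial (c := b) (j := jb) (by simp)
      (by simp) (by simp [pNeg, rNeg, rPos, hjb]) (by simp) (hb.resolve_left h2)
    refine ⟨T, ?_, by simp [hs', size], fun h => absurd h1 h⟩
    convert hT.mono _ using 1
    · have : jb ≠ ja := fun h => h2 (h ▸ h1)
      ext y; rcases y with (_ | _) | (_ | _) <;> simp [stoneOn, h1, h2, pNeg, rNeg, rPos] <;> grind
    · rintro x (rfl | hx)
      · exact ⟨jb, h2, hjb, rfl⟩
      · exact hx.elim
  all_goals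
    obtain ⟨T, hT, hi, hs', hI⟩ := (hd ∅).erase_rNeg trivial (c := a) (j := ja) (by simp)
      (by simp) (by simp [pNeg, rNeg, rPos, hja]) (by simp) (ha.resolve_left h1)
  · refine ⟨T, ?_, by simp [hs', size], fun _ => hI⟩
    convert hT.mono _ using 1
    · have : jb ≠ ja := fun h => h1 (h ▸ h2)
      ext y; rcases y with (_ | _) | (_ | _) <;> simp [stoneOn, h1, h2, pNeg, rNeg, rPos] <;> grind
    · rintro x (rfl | hx)
      · exact ⟨ja, h1, hja, rfl⟩
      · exact hx.elim
  -- For equal stones the two `¬r` literals are one and the same, and it is already gone.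
  · by_cases h3 : jb = ja
    · subst h3
      refine ⟨T, ?_, by simp [hs', size], fun _ => hI⟩
      convert hT.mono _ using 1
      · ext y; rcases y with (_ | _) | (_ | _) <;> simp [stoneOn, h1, pNeg, rNeg, rPos] <;> grind
      · rintro x (rfl | hx)
        · exact ⟨jb, h1, hja, rfl⟩
        · exact hx.elim
    · obtain ⟨T', hT', -, hs'', hI'⟩ := hT.erase_rNeg hi (c := b) (j := jb) (by simp [h3])
        (by simp [rNeg, pNeg, h3]) (by simp [pNeg, rNeg, rPos, hjb]) (by simp [rNeg, pNeg])
        (hb.resolve_left h2)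
      refine ⟨T', ?_, by simp [hs'', hs', size], fun _ => hI'⟩
      convert hT'.mono _ using 1
      · ext y; rcases y with (_ | _) | (_ | _) <;> simp [stoneOn, h1, h2, pNeg, rNeg, rPos] <;> grind
      · rintro x (rfl | rfl | hx)
        · exact ⟨jb, h2, hjb, rfl⟩
        · exact ⟨ja, h1, hja, rfl⟩
        · exact hx.elim

/-- Eliminating a predecessor `c` that is 3-learned. -/
theorem exists_eliminate {G : Digraph (Fin N)} {L : Set (Clause (StoneVar N m))}
    (hL : stone G m ⊆ L) (hm : 2 ≤ m) {W : Set (StoneVar N m)} {c : Fin N}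
    (hW : ∀ j, StoneVar.p c j ∉ W) (hc : Vertex3Learned L c) {H : Finset (Fin m)} {s : Fin m}
    (hs : s ∉ H) {Y : Clause (StoneVar N m)} (hsY : rPos s ∈ Y)
    (hY : ∀ t, pPos c t ∉ Y ∧ pNeg c t ∉ Y) {q : ℕ} (hq1 : 1 ≤ q)
    (T : Fin m → ProofTree (StoneVar N m))
    (hT : ∀ j, j ≠ s → IsDerivation L W (T j) (stoneOn H c j ∪ Y))
    (hq : ∀ j, j ≠ s → (T j).size ≤ q) :
    ∃ T', IsDerivation L (W ∪ {v | ∃ j, v = .p c j}) T' (H.image rNeg ∪ Y) ∧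
      T'.size ≤ 1 + m * (q + 1) ∧
      (∀ j, j ≠ s → (T j).inputDerived ⊆ T'.inputDerived) ∧
      ((∀ j, j ≠ s → (T j).IsFinishedLeaf) → T'.clause ∈ T'.inputDerived) := by
  classical
  obtain ⟨T', h1, h2, h3, h4⟩ := exists_sweep (Γ := L) (c := c)
    -- The stone `s` has no induction clause; the learned clause `¬p_{c,s} ∨ r_s` takes its place,
    -- and its `r_s` is in `Y` anyway.
    (fun j => if j = s then {rPos s} else (if j ∈ H then {rNeg j} else ∅) ∪ Y)
    (fun j => if j = s then finished {pNeg c s, rPos s} else T j) (q := q) hW (hL (.pebbled c))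
    (by
      intro j t
      have := hY t
      split_ifs <;> simp [pPos, pNeg, rPos, rNeg] at * <;> exact this)
    (by
      intro j
      by_cases hj : j = s
      · simpa [hj] using IsDerivation.leaf (hc s)
      · simpa [hj, stoneOn] using hT j hj)
    (by
      intro j
      by_cases hj : j = s
      · simpa [hj, size] using hq1
      · simpa [hj] using hq j hj)
    Finset.univ
  refine ⟨T', ?_, by simpa using h2, fun j hj => by simpa [hj] using h3 j (Finset.mem_univ j),
    fun h => (h4 fun j _ => ?_).2 ⟨s, by simp⟩⟩
  · convert h1 using 1
    · simp
    -- A stone other than `s` is needed for all of `Y` to occur in the result.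
    · have : Nontrivial (Fin m) := Fin.nontrivial_iff_two_le.2 hm
      obtain ⟨t, ht⟩ := exists_ne s
      ext y
      simp only [Finset.mem_union, Finset.mem_image, Finset.compl_univ, Finset.notMem_empty,
        Finset.mem_biUnion, Finset.mem_univ, true_and]
      constructor
      · rintro (⟨j, hj, rfl⟩ | hy)
        · have : j ≠ s := fun h => hs (h ▸ hj)
          exact Or.inr ⟨j, by simp [this, hj]⟩
        · exact Or.inr ⟨t, by simp [ht, hy]⟩
      · rintro (⟨a, h, -⟩ | ⟨j, hy⟩)
        · exact h.elim
        · split_ifs at hy with h5 h6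
          · rw [Finset.mem_singleton.1 hy]; exact Or.inr hsY
          · rcases Finset.mem_union.1 hy with hy | hy
            · exact Or.inl ⟨j, h6, (Finset.mem_singleton.1 hy).symm⟩
            · exact Or.inr hy
          · exact Or.inr (by simpa using hy)
  · by_cases hj : j = s
    · simp [hj, IsFinishedLeaf]
    · simpa [hj] using h j hj

/-! ### Side clauses at the vertices of the unfinished clause -/

variable {k : ℕ}

theorem mem_unfinishedClause {i : Fin (k + 1) → Fin N} {j : Fin (k + 1) → Fin m}
    {x : Literal (StoneVar N m)} : x ∈ unfinishedClause i j ↔ ∃ l, pNeg (i l) (j l) = x := by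
  simp [unfinishedClause]

/-- The stones on the vertices after `i_l`. -/
def laterStones (j : Fin (k + 1) → Fin m) (l : Fin (k + 1)) : Finset (Fin m) :=
  (Finset.univ.filter (l < ·)).image j

theorem mem_laterStones {j : Fin (k + 1) → Fin m} {l : Fin (k + 1)} {t : Fin m} :
    t ∈ laterStones j l ↔ ∃ y, l < y ∧ j y = t := by
  simp [laterStones]

/-- What remains of a predecessor `c` of `i_l` after its elimination: all literals are in the
unfinished clause or of the form `¬r_t` for a stone `t` in `H`, and a vertex `c` of the unfinished
clause contributes its stone. -/
structure IsResidue (i : Fin (k + 1) → Fin N) (j : Fin (k + 1) → Fin m) (H : Finset (Fin m))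
    (c : Fin N) (ρ : Clause (StoneVar N m)) : Prop where
  upper : ∀ x ∈ ρ, x ∈ unfinishedClause i j ∨ ∃ t ∈ H, x = rNeg t
  lower : ∀ y, c = i y → pNeg (i y) (j y) ∈ ρ ∧ rNeg (j y) ∈ ρ
  eq_of_mem : ∀ y, pNeg (i y) (j y) ∈ ρ → c = i y

/-- Treats the two kinds of predecessors uniformly. The residue `ρ` is fixed before `W` and `Y`,
because the elimination of the first predecessor is repeated for each stone on the second one and
must leave the same literals each time. -/
theorem exists_eliminate_residue {G : Digraph (Fin N)} {L : Set (Clause (StoneVar N m))}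
    (hL : stone G m ⊆ L) (hm : 2 ≤ m) {P : Clause (StoneVar N m)}
    {i : Fin (k + 1) → Fin N} {j : Fin (k + 1) → Fin m} (hi : Function.Injective i)
    (hP : unfinishedClause i j ⊆ P) {c : Fin N} {H : Finset (Fin m)} {s : Fin m} (hs : s ∉ H)
    (hc : (∃ y, c = i y ∧ j y ∈ H) ∨ (Vertex3Learned L c ∧ c ∉ dom P)) :
    ∃ ρ, IsResidue i j H c ρ ∧
      ∀ {W : Set (StoneVar N m)} {Y : Clause (StoneVar N m)} {q : ℕ},
        (∀ t, StoneVar.p c t ∉ W) → rPos s ∈ Y →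
        (c ∉ dom P → ∀ t, pPos c t ∉ Y ∧ pNeg c t ∉ Y) → 1 ≤ q →
        (∀ t, t ≠ s → (t ∈ H ∨ {pNeg c t, rPos t} ∈ L) →
          ∃ T, T.size ≤ q ∧ IsDerivation L W T (stoneOn H c t ∪ Y)) →
        ∃ T, T.size ≤ 1 + m * (q + 1) ∧
          IsDerivation L (W ∪ {x | ∃ t, x = .p c t ∧ c ∉ dom P}) T (ρ ∪ Y) := by
  rcases hc with ⟨y, rfl, hy⟩ | ⟨hc, hcP⟩
  · refine ⟨stoneOn H (i y) (j y), ⟨?_, ?_, ?_⟩, ?_⟩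
    · intro x hx
      simp only [stoneOn, hy, if_true, Finset.mem_insert, Finset.mem_singleton] at hx
      rcases hx with rfl | rfl
      · exact Or.inl (mem_unfinishedClause.2 ⟨y, rfl⟩)
      · exact Or.inr ⟨_, hy, rfl⟩
    · intro y' h
      obtain rfl := hi h
      simp [stoneOn, hy]
    · intro y' h
      simp only [stoneOn, hy, if_true, Finset.mem_insert, Finset.mem_singleton] at h
      simp only [pNeg, rNeg, Literal.neg.injEq, StoneVar.p.injEq, reduceCtorEq, or_false] at h
      exact h.1.symm
    · intro W Y q _ _ _ _ hT
      -- No elimination takes place here: only the derivation for the stone that `C` puts on this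
      -- vertex is used.
      obtain ⟨T, h1, h2⟩ := hT (j y) (fun h => hs (h ▸ hy)) (Or.inl hy)
      exact ⟨T, by have := (j y).pos; nlinarith, h2.mono Set.subset_union_left⟩
  · refine ⟨H.image rNeg, ⟨?_, ?_, ?_⟩, ?_⟩
    · intro x hx
      obtain ⟨t, ht, rfl⟩ := Finset.mem_image.1 hx
      exact Or.inr ⟨t, ht, rfl⟩
    · rintro y rfl
      exact absurd ⟨j y, hP (mem_unfinishedClause.2 ⟨y, rfl⟩)⟩ hcP
    · intro y h
      simp [pNeg, rNeg] at h
    · intro W Y q hW hsY hY hq1 hT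
      have : ∀ t, ∃ T, t ≠ s → T.size ≤ q ∧ IsDerivation L W T (stoneOn H c t ∪ Y) := by
        intro t
        by_cases ht : t = s
        · exact ⟨finished ∅, fun h => absurd ht h⟩
        · obtain ⟨T, hT⟩ := hT t ht (Or.inr (hc t))
          exact ⟨T, fun _ => hT⟩
      choose T hT using this
      obtain ⟨T', h1, h2, -⟩ := exists_eliminate hL hm hW hc hs hsY (hY hcP) hq1 T
        (fun t ht => (hT t ht).2) (fun t ht => (hT t ht).1)
      refine ⟨T', h2, h1.mono (Set.union_subset_union_right _ ?_)⟩
      rintro x ⟨t, rfl⟩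
      exact ⟨t, rfl, hcP⟩

/-- The clauses against which `¬r_{j_l}` is resolved at the vertex `i_l`. -/
structure IsSideClause (G : Digraph (Fin N)) (i : Fin (k + 1) → Fin N) (j : Fin (k + 1) → Fin m)
    (l : Fin (k + 1)) (Q : Clause (StoneVar N m)) : Prop where
  rPos_mem : rPos (j l) ∈ Q
  pNeg_mem : pNeg (i l) (j l) ∈ Q
  upper : ∀ x ∈ Q, x = rPos (j l) ∨ x ∈ unfinishedClause i j ∨ ∃ y, l < y ∧ x = rNeg (j y)
  rNeg_mem : ∀ y, pNeg (i y) (j y) ∈ Q → y = l ∨ (l < y ∧ rNeg (j y) ∈ Q)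
  predecessor_mem : ∀ y, G.Adj (i y) (i l) → pNeg (i y) (j y) ∈ Q

/-- The variables that may be resolved on above the vertices `i_l, i_{l+1}, …`. -/
def allowedVars (P : Clause (StoneVar N m)) (j : Fin (k + 1) → Fin m) (l : ℕ) :
    Set (StoneVar N m) :=
  {x | (∃ a t, x = .p a t ∧ a ∉ dom P) ∨ ∃ t, x = .r t ∧ ∀ y, l ≤ y.val → j y ≠ t}

theorem eq_or_eq_of_adj {n : ℕ} {G : Digraph (Fin N)} (hG : IsStoneDag G n) {a b v c : Fin N}
    (hab : ArePredecessors G a b v) (hc : G.Adj c v) : c = a ∨ c = b := by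
  have hv : v.val < n := by
    by_contra h
    exact (hG.source_iff v).2 (not_lt.1 h) _ hc
  by_contra! h
  have h3 : ({c, a, b} : Set (Fin N)).ncard = 3 := by
    rw [Set.ncard_insert_of_notMem (by simp [h.1, h.2]), Set.ncard_pair hab.1]
  have : ({c, a, b} : Set (Fin N)).ncard ≤ {i' | G.Adj i' v}.ncard := by
    refine Set.ncard_le_ncard ?_ (Set.toFinite _)
    rintro x (rfl | rfl | rfl)
    exacts [hc, hab.2.1, hab.2.2]
  rw [hG.indegree v hv] at this
  omega

/-- The predecessor `a` is treated inside, once for each relevant stone on `b`, and then `b`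
outside. The reserved stones are those of the vertices after `i_l`. They include the stone of any
predecessor in `dom C`, since edges run from larger to smaller vertices. -/
theorem exists_sideClause {n : ℕ} {G : Digraph (Fin N)} (hG : IsStoneDag G n)
    {L : Set (Clause (StoneVar N m))} (hL : stone G m ⊆ L) (hm : 2 ≤ m)
    {P : Clause (StoneVar N m)} {i : Fin (k + 1) → Fin N} {j : Fin (k + 1) → Fin m}
    (hi : StrictMono i) (hP : unfinishedClause i j ⊆ P) {l : Fin (k + 1)} (hl : ¬ Bypassed j l)
    {a b : Fin N} (hab : ArePredecessors G a b (i l))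
    (hpred : ∀ c, G.Adj c (i l) → (∃ y, c = i y) ∨ (Vertex3Learned L c ∧ c ∉ dom P)) :
    ∃ Q T, IsSideClause G i j l Q ∧ T.size ≤ 9 * m ^ 2 ∧ IsDerivation L (allowedVars P j l) T Q := by
  have hs : j l ∉ laterStones j l := fun h => hl (mem_laterStones.1 h)
  have hlt : ∀ y, G.Adj (i y) (i l) → l < y := fun y hy => hi.lt_iff_lt.1 (hG.edge_lt _ _ hy)
  have hpred' : ∀ c, G.Adj c (i l) →
      (∃ y, c = i y ∧ j y ∈ laterStones j l) ∨ (Vertex3Learned L c ∧ c ∉ dom P) := by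
    intro c hc
    rcases hpred c hc with ⟨y, rfl⟩ | h
    · exact Or.inl ⟨y, rfl, mem_laterStones.2 ⟨y, hlt y hc, rfl⟩⟩
    · exact Or.inr h
  have hav := (hG.edge_lt _ _ hab.2.1).ne'
  have hbv := (hG.edge_lt _ _ hab.2.2).ne'
  obtain ⟨ρa, hρa, hA⟩ := exists_eliminate_residue hL hm hi.injective hP hs (hpred' a hab.2.1)
  -- The size bound below is that of two nested sweeps over `m` stones around trees of size at most
  -- 5.
  obtain ⟨ρb, hρb, hB⟩ := exists_eliminate_residue hL hm hi.injective hP hs (hpred' b hab.2.2)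
  obtain ⟨T, hsize, hT⟩ := hB
    (W := {x | ∃ t, t ∉ laterStones j l ∧ t ≠ j l ∧ x = .r t} ∪
      {x | ∃ t, x = .p a t ∧ a ∉ dom P})
    (Y := ρa ∪ {pNeg (i l) (j l), rPos (j l)}) (q := 1 + m * (5 + 1))
    (by simp [hab.1.symm]) (by simp)
    (by
      intro hb t
      have hbi : ∀ y, i y ≠ b := by
        rintro y rfl
        exact hb ⟨j y, hP (mem_unfinishedClause.2 ⟨y, rfl⟩)⟩
      simp only [Finset.mem_union, Finset.mem_insert, Finset.mem_singleton, not_or]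
      refine ⟨⟨fun h => ?_, by simp [pPos, pNeg], by simp [pPos, rPos]⟩, ⟨fun h => ?_,
        by simp [pNeg, hbv], by simp [pNeg, rPos]⟩⟩
      all_goals
        rcases hρa.upper _ h with h | ⟨t, -, h⟩
        · obtain ⟨y, h⟩ := mem_unfinishedClause.1 h
          simp [pPos, pNeg, hbi] at h
        · simp [pPos, pNeg, rNeg] at h)
    (by omega)
    (by
      intro t ht htb
      obtain ⟨T, hsize, hT⟩ := hA (W := {x | ∃ t, t ∉ laterStones j l ∧ t ≠ j l ∧ x = .r t})
        (Y := stoneOn (laterStones j l) b t ∪ {pNeg (i l) (j l), rPos (j l)}) (q := 5)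
        (by simp) (by simp)
        (by
          intro _ t'
          have := hab.1
          unfold stoneOn
          split_ifs <;> simp [pPos, pNeg, rPos, rNeg, this, hav])
        (by omega)
        (by
          intro t' ht' hta
          obtain ⟨T, h1, h2, -⟩ := exists_stepDerivation hL hab ht' ht hta htb
          exact ⟨T, h2, h1⟩)
      refine ⟨T, hsize, ?_⟩
      rwa [Finset.union_left_comm] at hT)
  refine ⟨_, T, ⟨by simp, by simp, ?_, ?_, ?_⟩, by nlinarith, hT.mono ?_⟩
  · intro x hx
    have key : ∀ c ρ, IsResidue i j (laterStones j l) c ρ → x ∈ ρ →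
        x ∈ unfinishedClause i j ∨ ∃ y, l < y ∧ x = rNeg (j y) := by
      intro c ρ hρ hx
      rcases hρ.upper x hx with h | ⟨t, ht, rfl⟩
      · exact Or.inl h
      · obtain ⟨y, hy, rfl⟩ := mem_laterStones.1 ht
        exact Or.inr ⟨y, hy, rfl⟩
    simp only [Finset.mem_union, Finset.mem_insert, Finset.mem_singleton] at hx
    rcases hx with h | h | rfl | rfl
    · exact Or.inr (key _ _ hρb h)
    · exact Or.inr (key _ _ hρa h)
    · exact Or.inr (Or.inl (mem_unfinishedClause.2 ⟨l, rfl⟩))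
    · exact Or.inl rfl
  · intro y hy
    simp only [Finset.mem_union, Finset.mem_insert, Finset.mem_singleton] at hy ⊢
    rcases hy with h | h | h | h
    · obtain rfl := hρb.eq_of_mem y h
      exact Or.inr ⟨hlt y hab.2.2, Or.inl (hρb.lower y rfl).2⟩
    · obtain rfl := hρa.eq_of_mem y h
      exact Or.inr ⟨hlt y hab.2.1, Or.inr (Or.inl (hρa.lower y rfl).2)⟩
    · simp only [pNeg, Literal.neg.injEq, StoneVar.p.injEq] at h
      exact Or.inl (hi.injective h.1)
    · simp [pNeg, rPos] at h
  · intro y hy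
    simp only [Finset.mem_union]
    rcases eq_or_eq_of_adj hG hab hy with h | h
    · exact Or.inr (Or.inl (hρa.lower y h.symm).1)
    · exact Or.inl (hρb.lower y h.symm).1
  · rintro x ((⟨t, h1, h2, rfl⟩ | ⟨t, rfl, h⟩) | ⟨t, rfl, h⟩)
    · refine Or.inr ⟨t, rfl, fun y hy h => ?_⟩
      rcases (Fin.le_def.2 hy : l ≤ y).eq_or_lt with rfl | hy
      · exact h2 h.symm
      · exact h1 (mem_laterStones.2 ⟨y, hy, h⟩)
    · exact Or.inl ⟨_, _, rfl, h⟩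
    · exact Or.inl ⟨_, _, rfl, h⟩

/-! ### Learning at the last vertex -/

theorem KLearned.mono {L L' : Set (Clause (StoneVar N m))} (h : L ⊆ L') {a b v : Fin N}
    {s : Fin m} : ∀ {K : ℕ}, KLearned L a b v s K → KLearned L' a b v s K
  | 0, _ => trivial
  | 1, hL => fun j' j'' h' h'' => h (hL j' j'' h' h'')
  | 2, hL => fun j'' h'' => h (hL j'' h'')
  | 3, hL => h hL

/-- The side clause at the last vertex, from its two 3-learned predecessors `a`, `b`; its derivation
advances the learning of this clause. -/
theorem exists_derivation_kLearned {G : Digraph (Fin N)} {L : Set (Clause (StoneVar N m))}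
    (hL : stone G m ⊆ L) (hm : 2 ≤ m) {a b v : Fin N} (hab : ArePredecessors G a b v)
    (hav : a ≠ v) (hbv : b ≠ v) (ha : Vertex3Learned L a) (hb : Vertex3Learned L b) {s : Fin m}
    {K : ℕ} (hK : K < 3) (hKL : KLearned L a b v s K) :
    ∃ T, T.size ≤ 9 * m ^ 2 ∧
      IsDerivation L {x | (∃ t, x = .p a t ∨ x = .p b t) ∨ ∃ t, x = .r t ∧ t ≠ s} T
        {pNeg v s, rPos s} ∧
      KLearned T.inputDerived a b v s (K + 1) := by
  have hstone : ∀ c t, stoneOn (∅ : Finset (Fin m)) c t = {(pNeg c t : Literal (StoneVar N m))} :=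
    fun c t => by simp [stoneOn]
  have hbase : ∀ t, stoneOn (∅ : Finset (Fin m)) b t ∪ {pNeg v s, rPos s} =
      ({pNeg b t, pNeg v s, rPos s} : Clause (StoneVar N m)) := fun t => by
    rw [hstone, ← Finset.insert_eq]
  have hbase' : ∀ t' t, stoneOn (∅ : Finset (Fin m)) a t' ∪
      (stoneOn (∅ : Finset (Fin m)) b t ∪ {pNeg v s, rPos s}) =
      ({pNeg a t', pNeg b t, pNeg v s, rPos s} : Clause (StoneVar N m)) := fun t' t => by
    rw [hbase, hstone, ← Finset.insert_eq]
  have hba : b ≠ a := hab.1.symm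
  have hW₁ : ∀ t, StoneVar.p b t ∉ ({x | ∃ t, x = .r t ∧ t ≠ s} ∪ {x | ∃ t, x = .p a t} :
      Set (StoneVar N m)) := by simp [hba]
  have hY : ∀ t, pPos b t ∉ ({pNeg v s, rPos s} : Clause (StoneVar N m)) ∧
      pNeg b t ∉ ({pNeg v s, rPos s} : Clause (StoneVar N m)) := by
    simp [pPos, pNeg, rPos, hbv]
  have hmono : ({x | ∃ t, x = .r t ∧ t ≠ s} ∪ {x | ∃ t, x = .p a t}) ∪ {x | ∃ t, x = .p b t} ⊆
      ({x | (∃ t, x = .p a t ∨ x = .p b t) ∨ ∃ t, x = .r t ∧ t ≠ s} : Set (StoneVar N m)) := by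
    rintro x ((h | ⟨t, h⟩) | ⟨t, h⟩)
    · exact Or.inr h
    · exact Or.inl ⟨t, Or.inl h⟩
    · exact Or.inl ⟨t, Or.inr h⟩
  have hfirst : K < 2 → ∀ t, ∃ T, t ≠ s → T.size ≤ 1 + m * (5 + 1) ∧
      IsDerivation L ({x | ∃ t, x = .r t ∧ t ≠ s} ∪ {x | ∃ t, x = .p a t}) T
        (stoneOn ∅ b t ∪ {pNeg v s, rPos s}) ∧
      (K = 0 → ∀ t', t' ≠ s → {pNeg a t', pNeg b t, pNeg v s, rPos s} ∈ T.inputDerived) ∧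
      (K = 1 → {pNeg b t, pNeg v s, rPos s} ∈ T.inputDerived) := by
    intro hK t
    by_cases ht : t = s
    · exact ⟨finished ∅, fun h => absurd ht h⟩
    have hstep : ∀ t', ∃ T, t' ≠ s → T.size ≤ 5 ∧
        IsDerivation L {x | ∃ t, x = .r t ∧ t ≠ s} T
          (stoneOn ∅ a t' ∪ (stoneOn ∅ b t ∪ {pNeg v s, rPos s})) ∧
        (K = 0 → T.clause ∈ T.inputDerived) ∧ (K = 1 → T.IsFinishedLeaf) := by
      intro t'
      by_cases ht' : t' = s
      · exact ⟨finished ∅, fun h => absurd ht' h⟩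
      -- For `K = 0` the four-literal clauses are derived from Stone clauses by input derivations.
      -- For `K = 1` they are leaves, which makes the sweep over the stones of `a` an input
      -- derivation.
      obtain rfl | rfl : K = 0 ∨ K = 1 := by omega
      · obtain ⟨T, h1, h2, h3⟩ := exists_stepDerivation hL hab (H := ∅) ht' ht
          (Or.inr (ha t')) (Or.inr (hb t))
        refine ⟨T, fun _ => ⟨h2, h1.mono ?_, fun _ => h3 (by simp), by simp⟩⟩
        rintro x ⟨t, -, h, rfl⟩
        exact ⟨t, rfl, h⟩
      · refine ⟨_, fun _ => ⟨?_, .leaf ?_, by simp, fun _ => trivial⟩⟩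
        · simp [size]
        · exact (hbase' t' t).symm ▸ hKL t' t ht' ht
    choose T hT using hstep
    obtain ⟨T', h1, h2, h3, h4⟩ := exists_eliminate hL hm (c := a) (by simp) ha (H := ∅)
      (by simp) (Y := stoneOn ∅ b t ∪ {pNeg v s, rPos s}) (by simp)
      (by simp [hstone, pPos, pNeg, rPos, hav, hab.1]) (by omega) T
      (fun t' h => (hT t' h).2.1) (fun t' h => (hT t' h).1)
    rw [Finset.image_empty, Finset.empty_union] at h1
    refine ⟨T', fun _ => ⟨h2, h1, fun hK t' ht' => ?_, fun hK => ?_⟩⟩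
    · have := h3 t' ht' ((hT t' ht').2.2.1 hK)
      rwa [(hT t' ht').2.1.root, hbase'] at this
    · have := h4 fun t' ht' => (hT t' ht').2.2.2 hK
      rwa [h1.root, hbase] at this
  by_cases hK2 : K < 2
  · choose T hT using hfirst hK2
    obtain ⟨T', h1, h2, h3, -⟩ := exists_eliminate hL hm hW₁ hb (H := ∅)
      (by simp) (by simp) hY (by omega) T (fun t h => (hT t h).2.1) (fun t h => (hT t h).1)
    rw [Finset.image_empty, Finset.empty_union] at h1
    refine ⟨T', by nlinarith, h1.mono hmono, ?_⟩
    obtain rfl | rfl : K = 0 ∨ K = 1 := by omega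
    · exact fun t' t ht' ht => h3 t ht ((hT t ht).2.2.1 rfl t' ht')
    · exact fun t ht => h3 t ht ((hT t ht).2.2.2 rfl)
  -- Now the clauses without `a` are leaves, and the single sweep over the stones of `b` is input.
  · obtain rfl : K = 2 := by omega
    obtain ⟨T', h1, h2, -, h4⟩ := exists_eliminate hL hm hW₁ hb (H := ∅) (s := s)
      (by simp) (by simp) hY le_rfl (fun t => finished (stoneOn ∅ b t ∪ {pNeg v s, rPos s}))
      (fun t h => .leaf ((hbase t).symm ▸ hKL t h)) (fun t h => by simp [size])
    rw [Finset.image_empty, Finset.empty_union] at h1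
    refine ⟨T', by nlinarith, h1.mono hmono, ?_⟩
    have := h4 fun t _ => trivial
    rwa [h1.root] at this

/-! ### The main branch -/

/-- The invariant of the clauses on the main branch, after the vertices `i_y` with `y < l` have been
processed. -/
structure IsMainClause (G : Digraph (Fin N)) (i : Fin (k + 1) → Fin N) (j : Fin (k + 1) → Fin m)
    (l : ℕ) (M : Clause (StoneVar N m)) : Prop where
  first : pNeg (i 0) (j 0) ∈ M
  upper : ∀ x ∈ M, x ∈ unfinishedClause i j ∨ ∃ y, l ≤ y.val ∧ x = rNeg (j y)
  todo : ∀ x y, pNeg (i x) (j x) ∈ M → l ≤ y.val → j y = j x → rNeg (j x) ∈ M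
  done : ∀ x y, pNeg (i x) (j x) ∈ M → (∀ z, j z = j x → z.val < l) →
    DirectlySupports G i j y x → pNeg (i y) (j y) ∈ M

namespace IsMainClause

variable {G : Digraph (Fin N)} {i : Fin (k + 1) → Fin N} {j : Fin (k + 1) → Fin m}

theorem zero :
    IsMainClause G i j 0 {pNeg (i 0) (j 0), rNeg (j 0)} where
  first := by simp
  upper := by
    intro x hx
    simp only [Finset.mem_insert, Finset.mem_singleton] at hx
    rcases hx with rfl | rfl
    · exact Or.inl (mem_unfinishedClause.2 ⟨0, rfl⟩)
    · exact Or.inr ⟨0, Nat.zero_le _, rfl⟩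
  todo := by
    intro x y h _ _
    simp only [pNeg, rNeg, Finset.mem_insert, Finset.mem_singleton, Literal.neg.injEq,
      StoneVar.p.injEq, reduceCtorEq, or_false] at h
    rw [h.2]
    simp
  done := fun x y _ h => absurd (h x rfl) (Nat.not_lt_zero _)

variable {l : Fin (k + 1)} {M Q : Clause (StoneVar N m)}

/-- If `i_l` is bypassed, a later vertex carries the same stone and accounts for `¬r_{j_l}`. If
`¬r_{j_l}` is absent, `todo` shows that no collected vertex carries the stone `j_l`, so `done` makes
no new demand. -/
theorem skip (h : IsMainClause G i j l M) (hl : Bypassed j l ∨ rNeg (j l) ∉ M) :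
    IsMainClause G i j (l + 1) M where
  first := h.first
  upper := by
    intro x hx
    rcases h.upper x hx with h' | ⟨y, hy, rfl⟩
    · exact Or.inl h'
    · rcases (Fin.le_def.2 hy : l ≤ y).eq_or_lt with rfl | hy
      · obtain ⟨z, hz, e⟩ := hl.resolve_right (not_not.2 hx)
        exact Or.inr ⟨z, hz, by rw [e]⟩
      · exact Or.inr ⟨y, hy, rfl⟩
  todo := fun x y hx hy e => h.todo x y hx (by omega) e
  done := by
    intro x y hx hz hd
    refine h.done x y hx (fun z e => lt_of_le_of_ne (Nat.lt_succ_iff.1 (hz z e)) ?_) hd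
    intro hzl
    obtain rfl : z = l := Fin.ext hzl
    rcases hl with ⟨w, hw, e'⟩ | hl
    · have := hz w (e'.trans e)
      have := Fin.lt_def.1 hw
      omega
    · exact hl (e ▸ h.todo x z hx le_rfl e)

/-- Here `i_l` is the last vertex with its stone, so `¬r_{j_l}` may go for good, and the vertices
with this stone now owe their direct supporters; the side clause supplies them. -/
theorem resolve (h : IsMainClause G i j l M) (hl : ¬ Bypassed j l)
    (hQ : IsSideClause G i j l Q) :
    IsMainClause G i j (l + 1) (M.erase (rNeg (j l)) ∪ Q.erase (rPos (j l))) := by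
  have hM : ∀ c t, pNeg c t ∈ M → pNeg c t ∈ M.erase (rNeg (j l)) ∪ Q.erase (rPos (j l)) :=
    fun c t h => Finset.mem_union_left _ (Finset.mem_erase.2 ⟨by simp [pNeg, rNeg], h⟩)
  have hQ' : ∀ c t, pNeg c t ∈ Q → pNeg c t ∈ M.erase (rNeg (j l)) ∪ Q.erase (rPos (j l)) :=
    fun c t h => Finset.mem_union_right _ (Finset.mem_erase.2 ⟨by simp [pNeg, rPos], h⟩)
  have hmem : ∀ c t, pNeg c t ∈ M.erase (rNeg (j l)) ∪ Q.erase (rPos (j l)) →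
      pNeg c t ∈ M ∨ pNeg c t ∈ Q := fun c t h =>
    (Finset.mem_union.1 h).imp Finset.mem_of_mem_erase Finset.mem_of_mem_erase
  refine ⟨hM _ _ h.first, ?_, ?_, ?_⟩
  · intro x hx
    rcases Finset.mem_union.1 hx with hx | hx <;> obtain ⟨hne, hx⟩ := Finset.mem_erase.1 hx
    · rcases h.upper x hx with h' | ⟨y, hy, rfl⟩
      · exact Or.inl h'
      · rcases (Fin.le_def.2 hy : l ≤ y).eq_or_lt with rfl | hy
        · exact absurd rfl hne
        · exact Or.inr ⟨y, hy, rfl⟩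
    · rcases hQ.upper x hx with h' | h' | ⟨y, hy, h'⟩
      · exact absurd h' hne
      · exact Or.inl h'
      · exact Or.inr ⟨y, hy, h'⟩
  · intro x y hx hy e
    have hly : l < y := hy
    rcases hmem _ _ hx with hx | hx
    · refine Finset.mem_union_left _ (Finset.mem_erase.2 ⟨?_, h.todo x y hx (by omega) e⟩)
      intro h'
      simp only [rNeg, Literal.neg.injEq, StoneVar.r.injEq] at h'
      exact hl ⟨y, hly, e.trans h'⟩
    · rcases hQ.rNeg_mem x hx with rfl | ⟨-, hx⟩
      · exact absurd ⟨y, hly, e⟩ hl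
      · exact Finset.mem_union_right _ (Finset.mem_erase.2 ⟨by simp [rNeg, rPos], hx⟩)
  · intro x y hx hz hd
    -- Either `x` is bypassed and its max-bypasser is `l`, or `x = l` and the supporter is a
    -- predecessor of `i_l`.
    have hlast : j l = j x → pNeg (i y) (j y) ∈ M.erase (rNeg (j l)) ∪ Q.erase (rPos (j l)) := by
      intro e
      rcases hd with ⟨hxy, hd | ⟨hb, hd⟩⟩
      · have hyl : y = l := by
          refine le_antisymm (Fin.le_def.2 (Nat.lt_succ_iff.1 (hz y hd.1.2))) (hd.2 ⟨?_, e⟩)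
          have h1 := Fin.lt_def.1 hxy
          have h2 := hz y hd.1.2
          exact Fin.lt_def.2 (by omega)
        exact hyl ▸ hQ' _ _ hQ.pNeg_mem
      · have hxl : x = l := by
          refine le_antisymm (Fin.le_def.2 (Nat.lt_succ_iff.1 (hz x rfl))) ?_
          by_contra hlt
          exact hb ⟨l, not_le.1 hlt, e⟩
        subst hxl
        exact hQ' _ _ (hQ.predecessor_mem y hd)
    by_cases e : j l = j x
    · exact hlast e
    · rcases hmem _ _ hx with hx | hx
      · refine hM _ _ (h.done x y hx (fun z e' => lt_of_le_of_ne (Nat.lt_succ_iff.1 (hz z e')) ?_) hd)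
        intro hzl
        obtain rfl : z = l := Fin.ext hzl
        exact e e'
      · rcases hQ.rNeg_mem x hx with rfl | ⟨hlx, -⟩
        · exact absurd rfl e
        · have := hz x rfl
          have := Fin.lt_def.1 hlx
          omega

/-- When all vertices are processed no `¬r` literal can remain, and `done` propagates membership
from `i_1` along chains of direct support to every vertex. -/
theorem eq_unfinishedClause (h : IsMainClause G i j (k + 1) M) (hs : ∀ y, Supports G i j y 0) :
    M = unfinishedClause i j := by
  refine Finset.Subset.antisymm ?_ ?_
  · intro x hx
    rcases h.upper x hx with h' | ⟨y, hy, -⟩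
    · exact h'
    · have := y.isLt
      omega
  · intro x hx
    obtain ⟨y, rfl⟩ := mem_unfinishedClause.1 hx
    induction hs y using Relation.ReflTransGen.head_induction_on with
    | refl => exact h.first
    | head hd _ ih =>
      exact h.done _ _ (ih (mem_unfinishedClause.2 ⟨_, rfl⟩)) (fun z _ => z.isLt) hd

theorem isResolvent (h : IsMainClause G i j l M) (hl : ¬ Bypassed j l)
    (hQ : IsSideClause G i j l Q) (hM : rNeg (j l) ∈ M) :
    IsResolvent (rNeg (j l)) M Q (M.erase (rNeg (j l)) ∪ Q.erase (rPos (j l))) := by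
  refine ⟨hM, fun h' => ?_, hQ.rPos_mem, fun h' => ?_, rfl⟩
  · change rPos (j l) ∈ M at h'
    rcases h.upper _ h' with h' | ⟨y, -, h'⟩
    · obtain ⟨y, h'⟩ := mem_unfinishedClause.1 h'
      simp [pNeg, rPos] at h'
    · simp [rNeg, rPos] at h'
  · rcases hQ.upper _ h' with h' | h' | ⟨y, hy, h'⟩
    · simp [rNeg, rPos] at h'
    · obtain ⟨y, h'⟩ := mem_unfinishedClause.1 h'
      simp [pNeg, rNeg] at h'
    · simp only [rNeg, Literal.neg.injEq, StoneVar.r.injEq] at h'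
      exact hl ⟨y, hy, h'.symm⟩

end IsMainClause

/-- The resolution inference on the main branch at a vertex that is not bypassed. -/
theorem IsDerivation.resolve_sideClause {G : Digraph (Fin N)} {L : Set (Clause (StoneVar N m))}
    {P : Clause (StoneVar N m)} {i : Fin (k + 1) → Fin N} {j : Fin (k + 1) → Fin m}
    {l : Fin (k + 1)} {M Q : Clause (StoneVar N m)} {T S : ProofTree (StoneVar N m)}
    (hT : IsDerivation L (allowedVars P j l) T M) (hS : IsDerivation L (allowedVars P j l) S Q)
    (hM : IsMainClause G i j l M) (hl : ¬ Bypassed j l) (hQ : IsSideClause G i j l Q)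
    (hr : rNeg (j l) ∈ M) :
    IsDerivation L (allowedVars P j (l + 1))
      (node (M.erase (rNeg (j l)) ∪ Q.erase (rPos (j l))) (rNeg (j l)) T S)
      (M.erase (rNeg (j l)) ∪ Q.erase (rPos (j l))) := by
  refine (hT.resolve hS ?_ (hM.isResolvent hl hQ hr)).mono ?_
  · rintro (⟨_, _, h, -⟩ | ⟨t, h, h'⟩)
    · simp [rNeg, Literal.var] at h
    · simp only [rNeg, Literal.var, StoneVar.r.injEq] at h
      exact h' l le_rfl h
  · rintro x (rfl | h | ⟨t, rfl, h⟩)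
    · exact Or.inr ⟨j l, rfl, fun y hy e => hl ⟨y, hy, e⟩⟩
    · exact Or.inl h
    · exact Or.inr ⟨t, rfl, fun y hy => h y (by omega)⟩

/-- Stops before the last vertex, whose side clause needs the special derivation that advances the
learning. -/
theorem exists_mainClause {n : ℕ} {G : Digraph (Fin N)} (hG : IsStoneDag G n)
    {L : Set (Clause (StoneVar N m))} (hL : stone G m ⊆ L) (hm : 2 ≤ m)
    {P : Clause (StoneVar N m)} {i : Fin (k + 1) → Fin N} {j : Fin (k + 1) → Fin m}
    (hi : StrictMono i) (h0 : (i 0).val = 0) (hlast : (i (Fin.last k)).val < n)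
    (hP : unfinishedClause i j ⊆ P)
    (hpred : ∀ l, ¬ Bypassed j l → ∀ c, G.Adj c (i l) →
      (∃ y, c = i y) ∨ (Vertex3Learned L c ∧ c ∉ dom P)) (l : ℕ) (hl : l ≤ k) :
    ∃ M T, IsMainClause G i j l M ∧ T.size ≤ 1 + l * (9 * m ^ 2 + 1) ∧
      IsDerivation L (allowedVars P j l) T M := by
  induction l with
  | zero =>
    exact ⟨_, finished _, .zero, by simp [size], .leaf (hL (.sink _ _ h0))⟩
  | succ l ih =>
    obtain ⟨M, T, hM, hsize, hT⟩ := ih (by omega)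
    obtain ⟨l, rfl⟩ : ∃ l' : Fin (k + 1), l'.val = l := ⟨⟨l, by omega⟩, rfl⟩
    by_cases hb : Bypassed j l ∨ rNeg (j l) ∉ M
    · refine ⟨M, T, hM.skip hb, by nlinarith, hT.mono ?_⟩
      rintro x (h | ⟨t, rfl, h⟩)
      · exact Or.inl h
      · exact Or.inr ⟨t, rfl, fun y hy => h y (by omega)⟩
    · push Not at hb
      have hn : (i l).val < n := (Fin.le_def.1 (hi.monotone (Fin.le_last l))).trans_lt hlast
      obtain ⟨a, b, hne, hset⟩ := Set.ncard_eq_two.1 (hG.indegree (i l) hn)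
      have hab : ArePredecessors G a b (i l) :=
        ⟨hne, (Set.ext_iff.1 hset a).2 (by simp), (Set.ext_iff.1 hset b).2 (by simp)⟩
      obtain ⟨Q, S, hQ, hS, hS'⟩ := exists_sideClause hG hL hm hi hP hb.1 hab (hpred l hb.1)
      exact ⟨_, _, hM.resolve hb.1 hQ, by simp only [size]; linarith,
        hT.resolve_sideClause hS' hM hb.1 hQ hb.2⟩

/-! ### Assembling the derivation -/

/-- The derivation `RC` of a well-formed, non-extendible clause. The clauses that make
`¬p_{i_k,j_k} ∨ r_{j_k}` `(K + 1)`-learned are all derived in `RC` itself, and so they are learned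
in the refutation in which `RC` replaces the leftmost unfinished leaf of `R`. -/
theorem exists_regRTIDerivation {n : ℕ} {G : Digraph (Fin N)} (hG : IsStoneDag G n) (hNm : N ≤ m)
    {R : ProofTree (StoneVar N m)} {i : Fin (k + 1) → Fin N} {j : Fin (k + 1) → Fin m}
    {P : Clause (StoneVar N m)} (hR : R.leftmostUnfinished = some (unfinishedClause i j, P))
    (hwf : IsWellFormed G n (learnedClauses (stone G m) R) P i j)
    (hext : ¬ Extendible G (learnedClauses (stone G m) R) i j) {a b : Fin N}
    (hab : ArePredecessors G a b (i (Fin.last k))) {K : ℕ} (hK : K < 3)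
    (hKL : KLearned (learnedClauses (stone G m) R) a b (i (Fin.last k)) (j (Fin.last k)) K) :
    ∃ RC, IsRegRTIDerivation (learnedClauses (stone G m) R) RC (unfinishedClause i j) ∧
      RC.size ≤ 11 * (N * m ^ 2) ∧
      (∀ v ∈ RC.resVars, (∃ s, v = .r s) ∨ ∃ a s, v = .p a s ∧ a ∉ dom P) ∧
      KLearned RC.inputDerived a b (i (Fin.last k)) (j (Fin.last k)) (K + 1) ∧
      KLearned (learnedClauses (stone G m) (replaceLeftmost RC R)) a b (i (Fin.last k))
        (j (Fin.last k)) (K + 1) := by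
  set L := learnedClauses (stone G m) R
  have hL : stone G m ⊆ L := Set.subset_union_left
  have hP := subset_of_leftmostUnfinished_eq_some hR
  have hi := hwf.strictMono
  -- Two distinct predecessors force `N ≥ 2`.
  have hm : 2 ≤ m := by
    have h1 := a.isLt
    have h2 := b.isLt
    have h3 := Fin.val_ne_of_ne hab.1
    omega
  have hpred : ∀ l, ¬ Bypassed j l → ∀ c, G.Adj c (i l) →
      (∃ y, c = i y) ∨ (Vertex3Learned L c ∧ c ∉ dom P) := by
    intro l hl c hc
    rcases hwf.predecessors l hl c hc with ⟨t, ht⟩ | h | h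
    · obtain ⟨y, h⟩ := mem_unfinishedClause.1 ht
      simp only [pNeg, Literal.neg.injEq, StoneVar.p.injEq] at h
      exact Or.inl ⟨y, h.1.symm⟩
    · exact Or.inr h
    · exact absurd ⟨l, hl, c, hc, h⟩ hext
  have hb : ¬ Bypassed j (Fin.last k) := fun ⟨y, hy, _⟩ => absurd hy (not_lt.2 (Fin.le_last y))
  -- A predecessor of `i_k` exceeds `i_k`, the largest vertex of `C`, so it cannot lie in `dom C`.
  have hlearned : ∀ c, G.Adj c (i (Fin.last k)) → Vertex3Learned L c ∧ c ∉ dom P := by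
    intro c hc
    rcases hpred _ hb c hc with ⟨y, rfl⟩ | h
    · exact absurd (hi.lt_iff_lt.1 (hG.edge_lt _ _ hc)) (not_lt.2 (Fin.le_last y))
    · exact h
  have hadj : ∀ y, ¬ G.Adj (i y) (i (Fin.last k)) := fun y hy =>
    (hlearned _ hy).2 ⟨j y, hP (mem_unfinishedClause.2 ⟨y, rfl⟩)⟩
  obtain ⟨M, T, hM, hTsize, hT⟩ :=
    exists_mainClause hG hL hm hi hwf.first hwf.last hP hpred k le_rfl
  obtain ⟨S, hSsize, hS, hSK⟩ := exists_derivation_kLearned hL hm hab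
    (hG.edge_lt _ _ hab.2.1).ne' (hG.edge_lt _ _ hab.2.2).ne' (hlearned a hab.2.1).1
    (hlearned b hab.2.2).1 hK hKL
  have hr : rNeg (j (Fin.last k)) ∈ M := by
    by_contra hr
    have hC := (hM.skip (l := Fin.last k) (Or.inr hr)).eq_unfinishedClause hwf.supports
    exact hr (hM.todo (Fin.last k) (Fin.last k) (hC ▸ mem_unfinishedClause.2 ⟨_, rfl⟩) le_rfl rfl)
  have hQ : IsSideClause G i j (Fin.last k) {pNeg (i (Fin.last k)) (j (Fin.last k)),
      rPos (j (Fin.last k))} := by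
    refine ⟨by simp, by simp, ?_, ?_, fun y hy => absurd hy (hadj y)⟩
    · intro x hx
      simp only [Finset.mem_insert, Finset.mem_singleton] at hx
      rcases hx with rfl | rfl
      · exact Or.inr (Or.inl (mem_unfinishedClause.2 ⟨_, rfl⟩))
      · exact Or.inl rfl
    · intro y hy
      simp only [pNeg, rPos, Finset.mem_insert, Finset.mem_singleton, Literal.neg.injEq,
        StoneVar.p.injEq, reduceCtorEq, or_false] at hy
      exact Or.inl (hi.injective hy.1)
  have hRC := hT.resolve_sideClause (l := Fin.last k) (P := P) (hS.mono ?_) hM hb hQ hr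
  · have hC := (hM.resolve (l := Fin.last k) hb hQ).eq_unfinishedClause hwf.supports
    have hvars : ∀ v ∈ allowedVars P j (Fin.last k + 1 : ℕ), (∃ s, v = .r s) ∨
        ∃ a s, v = .p a s ∧ a ∉ dom P := by
      rintro v (h | ⟨t, rfl, -⟩)
      · exact Or.inr h
      · exact Or.inl ⟨t, rfl⟩
    refine ⟨_, ⟨hRC.complete, hRC.root.trans hC, hRC.valid, hRC.regular, ?_⟩, ?_,
      fun v hv => hvars v (hRC.resVars_subset hv), ?_⟩
    · intro x hx hx'
      obtain ⟨y, rfl⟩ := mem_unfinishedClause.1 hx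
      rcases hvars _ (hRC.resVars_subset hx') with ⟨s, h⟩ | ⟨c, s, h, hc⟩
      · simp [pNeg, Literal.var] at h
      · simp only [pNeg, Literal.var, StoneVar.p.injEq] at h
        exact hc ⟨j y, h.1 ▸ hP hx⟩
    -- The total size is at most `1 + (k + 1)(9m^2 + 1)`, with one summand for each of the `k + 1`
    -- distinct vertices; the constant 11 leaves some slack.
    · have hkN : k + 1 ≤ N := by simpa using Fintype.card_le_of_injective i hi.injective
      have h1 : (k + 1) * (9 * m ^ 2 + 1) ≤ N * (9 * m ^ 2 + 1) := Nat.mul_le_mul_right _ hkN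
      have h2 : 1 ≤ N := by omega
      have h3 : 4 ≤ m ^ 2 := by nlinarith
      have h4 : N * 4 ≤ N * m ^ 2 := Nat.mul_le_mul_left _ h3
      simp only [size]
      linarith
    · have hsub : S.inputDerived ⊆ (node (M.erase (rNeg (j (Fin.last k))) ∪
          ({pNeg (i (Fin.last k)) (j (Fin.last k)), rPos (j (Fin.last k))} :
            Clause (StoneVar N m)).erase (rPos (j (Fin.last k)))) (rNeg (j (Fin.last k)))
          T S).inputDerived := fun D hD => Or.inl (Or.inr hD)
      have hcomplete : R.isComplete ≠ true := fun h => by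
        rw [leftmostUnfinished_eq_none_iff.2 h] at hR
        cases hR
      exact ⟨hSK.mono hsub, hSK.mono fun D hD => Or.inr
        (inputDerived_subset_replaceLeftmost_of_not_isComplete _ hcomplete (hsub hD))⟩
  · rintro x (⟨t, rfl | rfl⟩ | ⟨t, rfl, h⟩)
    · exact Or.inl ⟨a, t, rfl, (hlearned a hab.2.1).2⟩
    · exact Or.inl ⟨b, t, rfl, (hlearned b hab.2.2).2⟩
    · refine Or.inr ⟨t, rfl, fun y hy => ?_⟩
      obtain rfl : y = Fin.last k := le_antisymm (Fin.le_last y) hy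
      exact h.symm

end StoneRTI

theorem mainTheorem4 :
    ∃ c : ℕ, ∀ (N m n : ℕ) (G : Digraph (Fin N)), IsStoneDag G n → N ≤ m →
      ∀ R : ProofTree (StoneVar N m), IsPartialRegRTIRefutation (stone G m) R →
      ∀ (k : ℕ) (i : Fin (k + 1) → Fin N) (j : Fin (k + 1) → Fin m)
        (P : Clause (StoneVar N m)),
        R.leftmostUnfinished = some (unfinishedClause i j, P) →
        IsWellFormed G n (learnedClauses (stone G m) R) P i j →
        ¬ Extendible G (learnedClauses (stone G m) R) i j →
      ∀ i' i'' : Fin N, ArePredecessors G i' i'' (i (Fin.last k)) →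
      ∀ K : ℕ, K < 3 →
        KLearned (learnedClauses (stone G m) R) i' i'' (i (Fin.last k)) (j (Fin.last k)) K →
      ∃ RC : ProofTree (StoneVar N m),
        IsRegRTIDerivation (learnedClauses (stone G m) R) RC (unfinishedClause i j) ∧
        RC.size ≤ c * (N * m ^ 2) ∧
        (∀ v ∈ RC.resVars, (∃ s, v = .r s) ∨ ∃ a s, v = .p a s ∧ a ∉ dom P) ∧
        KLearned (learnedClauses (stone G m) (R.replaceLeftmost RC)) i' i''
          (i (Fin.last k)) (j (Fin.last k)) (K + 1) := by
  refine ⟨11, fun N m n G hG hNm R _ k i j P hR hwf hext a b hab K hK hKL => ?_⟩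
  obtain ⟨RC, hRC, hsize, hvars, hlearned, -⟩ :=
    exists_regRTIDerivation hG hNm hR hwf hext hab hK hKL
  refine ⟨RC, hRC, hsize, hvars, hlearned.mono ?_⟩
  -- Dot notation makes `R` the first explicit argument, the tree to be inserted, so
  -- `R.replaceLeftmost RC` inserts `R` into the complete tree `RC` and equals `RC`. The goal
  -- therefore concerns what is learned within `RC` itself; the last conjunct of
  -- `exists_regRTIDerivation` covers the replacement of the leaf of `R` by `RC`.
  rw [ProofTree.replaceLeftmost_of_isComplete R hRC.complete]
  exact Set.subset_union_right
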